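/- Let $X$ be a non-empty compact metric space with metric $d$, $T:X\to X$ a continuous map and $f:X\to\mathbb R$ a continuous function. For $n\in\mathbb N$ put $S_nf(x)=\sum_{j=0}^{n-1}f(T^jx)$, $d_n(x,y)=\max_{0\le j\le n-1}d(T^jx,T^jy)$, $B_n(x,\delta)=\{y:d_n(x,y)<\delta\}$ and $\overline B_n(x,\delta)=\{y:d_n(x,y)\le\delta\}$. For non-empty $Z\subset X$ and $\delta>0$ define the following quantities, with values in $[-\infty,\infty]$. (i) A set $E\subset X$ is $(n,\delta)$-spanning for $Z$ if every $x\in Z$ has some $y\in E$ with $d_n(x,y)<\delta$. Let $P_n(Z,\delta)=\inf_E\sum_{x\in E}(1/\delta)^{S_nf(x)}$ over all such $E$, let $P(Z,\delta)=\limsup_{n\to\infty}\frac1n\log P_n(Z,\delta)$, and define the upper metric mean dimension with potential $f$ of $Z$ by $$\overline{\mathrm{mdim}}_M(T,f,Z,d)=\limsup_{\delta\to0}\frac{P(Z,\delta)}{\log(1/\delta)}.$$ (ii) For $s\in\mathbb R$ and $N\in\mathbb N$ let $M^s_{N,\delta}(Z)=\inf\sum_{i\in I}e^{-n_is+\log(1/\delta)\,S_{n_i}f(x_i)}$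 over all finite or countable covers $\{B_{n_i}(x_i,\delta)\}_{i\in I}$ of $Z$ with $n_i\ge N$, $x_i\in X$. Let $M^s_\delta(Z)=\lim_{N\to\infty}M^s_{N,\delta}(Z)$ and $M_\delta(Z)=\inf\{s:M^s_\delta(Z)=0\}$, and define the Bowen upper metric mean dimension with potential $f$ on $Z$ by $$\overline{\mathrm{mdim}}^B_M(T,f,Z,d)=\limsup_{\delta\to0}\frac{M_\delta(Z)}{\log(1/\delta)}.$$ (iii) For $A\subset X$, $s\in\mathbb R$ and $N\in\mathbb N$ let $P^s_{N,\delta}(A)=\sup\sum_{i\in I}e^{-n_is+\log(1/\delta)\,S_{n_i}f(x_i)}$ over all finite or countable pairwise disjoint families $\{\overline B_{n_i}(x_i,\delta)\}_{i\in I}$ with $n_i\ge N$, $x_i\in A$. Let $P^s_\delta(A)=\lim_{N\to\infty}P^s_{N,\delta}(A)$, $\mathcal P^s_\delta(Z)=\inf\{\sum_{i\ge1}P^s_\delta(Z_i):Z\subset\bigcup_{i\ge1}Z_i\}$ and $\mathcal P_\delta(Z)=\inf\{s:\mathcal P^s_\delta(Z)=0\}$, and define the packing upper metric mean dimension with potential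 $f$ on $Z$ by $$\overline{\mathrm{mdim}}^P_M(T,f,Z,d)=\limsup_{\delta\to0}\frac{\mathcal P_\delta(Z)}{\log(1/\delta)}.$$ Then for every $\epsilon>0$ and all integers $n\ge m\ge0$, writing $W^s_{\epsilon,[m,n]}(x,T)=\{y\in X:d(T^jx,T^jy)\le\epsilon\text{ for all }m\le j\le n\}$ for the $(m,n)$-block of the $\epsilon$-stable set of $x$, $$\overline{\mathrm{mdim}}_M(T,f,X,d)=\max_{x\in X}\overline{\mathrm{mdim}}^B_M(T,f,W^s_{\epsilon,[m,n]}(x,T),d)=\max_{x\in X}\overline{\mathrm{mdim}}^P_M(T,f,W^s_{\epsilon,[m,n]}(x,T),d)=\max_{x\in X}\overline{\mathrm{mdim}}_M(T,f,W^s_{\epsilon,[m,n]}(x,T),d),$$ where all three maxima are attained. (The case $f=0$ gives the corresponding equalities for the metric mean dimensions without potential.) -/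

import Mathlib

open Filter Topology
open scoped NNReal ENNReal

noncomputable section

namespace MeanDim

variable {X : Type*} [MetricSpace X]

/-- The Bowen metric `d_n(x, y) = max_{0 ≤ j ≤ n - 1} d(T^j x, T^j y)`. -/
def bowenDist (T : X → X) (n : ℕ) (x y : X) : ℝ :=
  (((Finset.range n).sup fun j => nndist (T^[j] x) (T^[j] y) : ℝ≥0) : ℝ)

/-- The open Bowen ball `B_n(x, ε)`. -/
def bowenBall (T : X → X) (n : ℕ) (x : X) (ε : ℝ) : Set X :=
  {y | bowenDist T n x y < ε}

/-- The closed Bowen ball. -/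
def closedBowenBall (T : X → X) (n : ℕ) (x : X) (ε : ℝ) : Set X :=
  {y | bowenDist T n x y ≤ ε}

/-- The `(m, n)`-block of the `ε`-stable set of `x`. -/
def stableBlock (T : X → X) (ε : ℝ) (m n : ℕ) (x : X) : Set X :=
  {y | ∀ j ∈ Finset.Icc m n, dist (T^[j] x) (T^[j] y) ≤ ε}

/-- `E ⊆ X` is an `(n, ε)`-spanning set of `Z`. -/
def IsSpanningSet (T : X → X) (n : ℕ) (ε : ℝ) (Z E : Set X) : Prop :=
  ∀ x ∈ Z, ∃ y ∈ E, bowenDist T n x y < ε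

/-- `P_n(T, f, Z, d, ε) = inf_E ∑_{x ∈ E} (1/ε)^{S_n f(x)}` over the `(n, ε)`-spanning sets `E`
of `Z`; here `S_n f(x) = birkhoffSum T f n x`. -/
def spanningSum (T : X → X) (f : X → ℝ) (Z : Set X) (ε : ℝ) (n : ℕ) : ℝ≥0∞ :=
  ⨅ (E : Set X) (_ : IsSpanningSet T n ε Z E),
    ∑' x : E, ENNReal.ofReal ((1 / ε) ^ birkhoffSum T f n (x : X))

/-- `P(T, f, Z, d, ε) = limsup_n (1/n) log P_n(T, f, Z, d, ε)`. -/
def spanningPressure (T : X → X) (f : X → ℝ) (Z : Set X) (ε : ℝ) : EReal :=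
  limsup (fun n : ℕ => ENNReal.log (spanningSum T f Z ε n) / (n : EReal)) atTop

/-- The upper metric mean dimension with potential `f` of `Z`. -/
def upperMdim (T : X → X) (f : X → ℝ) (Z : Set X) : EReal :=
  limsup (fun ε : ℝ => spanningPressure T f Z ε / ((Real.log (1 / ε) : ℝ) : EReal)) (𝓝[>] 0)

/-- The weight `exp(-n s + log(1/ε) S_n f(x))` of the Bowen ball of length `n = p.1` and
centre `x = p.2`. -/
def ballWeight (T : X → X) (f : X → ℝ) (ε s : ℝ) (p : ℕ × X) : ℝ≥0∞ :=
  ENNReal.ofReal (Real.exp (-(p.1 : ℝ) * s + Real.log (1 / ε) * birkhoffSum T f p.1 p.2))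

/-- A countable family `{B_{n_i}(x_i, ε)}` with `n_i ≥ N`, `x_i ∈ X` that covers `Z`, given as the
set of its pairs `(n_i, x_i)`. -/
def IsBowenCover (T : X → X) (Z : Set X) (ε : ℝ) (N : ℕ) (C : Set (ℕ × X)) : Prop :=
  C.Countable ∧ (∀ p ∈ C, N ≤ p.1) ∧ Z ⊆ ⋃ p ∈ C, bowenBall T p.1 p.2 ε

/-- `M_{N,ε}^s(T, f, Z, d)`. -/
def bowenPre (T : X → X) (f : X → ℝ) (Z : Set X) (ε s : ℝ) (N : ℕ) : ℝ≥0∞ :=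
  ⨅ (C : Set (ℕ × X)) (_ : IsBowenCover T Z ε N C), ∑' p : C, ballWeight T f ε s p

/-- `M_ε^s(T, f, Z, d)`: the limit of `M_{N,ε}^s` as `N → ∞`, which is a supremum because
`M_{N,ε}^s` is nondecreasing in `N`. -/
def bowenOuter (T : X → X) (f : X → ℝ) (Z : Set X) (ε s : ℝ) : ℝ≥0∞ :=
  ⨆ N : ℕ, bowenPre T f Z ε s N

/-- The critical value `M_ε(T, f, Z, d) = inf {s ∈ ℝ : M_ε^s = 0}`. -/
def bowenCritical (T : X → X) (f : X → ℝ) (Z : Set X) (ε : ℝ) : EReal :=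
  ⨅ (s : ℝ) (_ : bowenOuter T f Z ε s = 0), (s : EReal)

/-- The Bowen upper metric mean dimension with potential `f` on `Z`. -/
def bowenUpperMdim (T : X → X) (f : X → ℝ) (Z : Set X) : EReal :=
  limsup (fun ε : ℝ => bowenCritical T f Z ε / ((Real.log (1 / ε) : ℝ) : EReal)) (𝓝[>] 0)

/-- A countable pairwise disjoint family of closed Bowen balls of radius `ε` with `n_i ≥ N` and
centres `x_i ∈ Z`, given as the set of its pairs `(n_i, x_i)`. (For `ε > 0` the balls are nonempty,
so that members of a disjoint family with different indices have different pairs.) -/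
def IsBowenPacking (T : X → X) (Z : Set X) (ε : ℝ) (N : ℕ) (C : Set (ℕ × X)) : Prop :=
  C.Countable ∧ (∀ p ∈ C, N ≤ p.1 ∧ p.2 ∈ Z) ∧
    C.PairwiseDisjoint fun p => closedBowenBall T p.1 p.2 ε

/-- `P_{N,ε}^s(T, f, Z, d)`. -/
def packingPre (T : X → X) (f : X → ℝ) (Z : Set X) (ε s : ℝ) (N : ℕ) : ℝ≥0∞ :=
  ⨆ (C : Set (ℕ × X)) (_ : IsBowenPacking T Z ε N C), ∑' p : C, ballWeight T f ε s p

/-- `P_ε^s(T, f, Z, d)`: the limit of `P_{N,ε}^s` as `N → ∞`, which is an infimum because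
`P_{N,ε}^s` is nonincreasing in `N`. -/
def packingLim (T : X → X) (f : X → ℝ) (Z : Set X) (ε s : ℝ) : ℝ≥0∞ :=
  ⨅ N : ℕ, packingPre T f Z ε s N

/-- `𝒫_ε^s(T, f, Z, d) = inf {∑_i P_ε^s(T, f, Z_i, d) : Z ⊆ ⋃_i Z_i}`. -/
def packingOuter (T : X → X) (f : X → ℝ) (Z : Set X) (ε s : ℝ) : ℝ≥0∞ :=
  ⨅ (A : ℕ → Set X) (_ : Z ⊆ ⋃ i, A i), ∑' i, packingLim T f (A i) ε s

/-- The critical value `𝒫_ε(T, f, Z, d) = inf {s ∈ ℝ : 𝒫_ε^s = 0}`. -/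
def packingCritical (T : X → X) (f : X → ℝ) (Z : Set X) (ε : ℝ) : EReal :=
  ⨅ (s : ℝ) (_ : packingOuter T f Z ε s = 0), (s : EReal)

/-- The packing upper metric mean dimension with potential `f` on `Z`. -/
def packingUpperMdim (T : X → X) (f : X → ℝ) (Z : Set X) : EReal :=
  limsup (fun ε : ℝ => packingCritical T f Z ε / ((Real.log (1 / ε) : ℝ) : EReal)) (𝓝[>] 0)

end MeanDim

end

open Filter Topology
open scoped NNReal ENNReal

noncomputable section

namespace MeanDim

/-! ### Comparing upper limits of `F δ / log (1 / δ)` -/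

/-! On every set, Bowen ≤ packing ≤ spanning dimension (`bowenUpperMdim_le_packingUpperMdim`,
`packingUpperMdim_le_upperMdim`), and spanning dimension is monotone; so the value on `X` bounds all
three quantities on each block. It remains to find one block whose Bowen dimension reaches that
value.

A block constrains only finitely many iterates, so it is a neighbourhood of its point and finitely
many blocks cover `X`. Bowen dimension is stable under finite unions (`exists_bowenUpperMdim_le`),
so some block has at least the Bowen dimension of `X`.

On the compact space `X` this is at least the spanning dimension
(`upperMdim_univ_le_bowenUpperMdim_univ`): a finite cover by Bowen balls of total weight at most 1
can be concatenated along orbits without increasing the total, giving covers of every length `n`.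
Pieces of bounded `d_n`-diameter, weighted by suprema, replace balls here, since a concatenated
piece has no natural centre.

Each comparison loses a constant factor in the scale, a bounded term, or `η * log (1 / δ)` from the
oscillation of `f`; all vanish after division by `log (1 / δ)` and `η → 0`. -/

lemma tendsto_log_one_div_nhdsGT_zero :
    Tendsto (fun δ : ℝ => Real.log (1 / δ)) (𝓝[>] 0) atTop := by
  simp_rw [one_div]
  exact Real.tendsto_log_atTop.comp tendsto_inv_nhdsGT_zero

lemma eventually_lt_of_limsup_div_log_lt {G : ℝ → EReal} {a : ℝ}
    (h : limsup (fun δ : ℝ => G δ / ((Real.log (1 / δ) : ℝ) : EReal)) (𝓝[>] 0) < a) :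
    ∀ᶠ δ in 𝓝[>] (0 : ℝ), G δ < ((a * Real.log (1 / δ) : ℝ) : EReal) := by
  filter_upwards [eventually_lt_of_limsup_lt h,
    tendsto_log_one_div_nhdsGT_zero.eventually_gt_atTop 0] with δ hδ hpos
  rwa [EReal.div_lt_iff (by exact_mod_cast hpos) (EReal.coe_ne_top _), ← EReal.coe_mul] at hδ

lemma limsup_div_log_le {F : ℝ → EReal} {a k C : ℝ} (hk : 0 < k)
    (h : ∀ η > 0, ∀ᶠ δ in 𝓝[>] (0 : ℝ),
      F (k * δ) ≤ ((a * Real.log (1 / δ) + η * Real.log (1 / δ) + C : ℝ) : EReal)) :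
    limsup (fun δ : ℝ => F δ / ((Real.log (1 / δ) : ℝ) : EReal)) (𝓝[>] 0) ≤ a := by
  refine EReal.le_of_forall_lt_iff_le.1 fun b hab => ?_
  have hab : a < b := by exact_mod_cast hab
  -- Since `b = a + 2 * η`, one `η` is the error allowed by `h`; the other absorbs `(a + η) * log k
  -- + C` once `δ` is small.
  set η := (b - a) / 2 with hη
  have hη0 : 0 < η := by rw [hη]; linarith
  have hscale : Tendsto (fun δ : ℝ => k⁻¹ * δ) (𝓝[>] 0) (𝓝[>] 0) := by
    refine tendsto_nhdsWithin_iff.2 ⟨?_, ?_⟩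
    · have : Tendsto (fun δ : ℝ => k⁻¹ * δ) (𝓝 0) (𝓝 (k⁻¹ * 0)) := tendsto_id.const_mul _
      rw [mul_zero] at this
      exact this.mono_left nhdsWithin_le_nhds
    · filter_upwards [self_mem_nhdsWithin] with δ hδ
      exact mul_pos (inv_pos.2 hk) hδ
  refine limsup_le_of_le (h := ?_)
  filter_upwards [hscale.eventually (h η hη0), self_mem_nhdsWithin,
    tendsto_log_one_div_nhdsGT_zero.eventually_gt_atTop 0,
    tendsto_log_one_div_nhdsGT_zero.eventually_ge_atTop (((a + η) * Real.log k + C) / η)]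
    with δ hδ hδ0 hpos hlarge
  have hδ0 : 0 < δ := hδ0
  rw [EReal.div_le_iff_le_mul (by exact_mod_cast hpos) (EReal.coe_ne_top _), ← EReal.coe_mul]
  rw [mul_inv_cancel_left₀ hk.ne'] at hδ
  refine hδ.trans (EReal.coe_le_coe_iff.2 ?_)
  have hlog : Real.log (1 / (k⁻¹ * δ)) = Real.log k + Real.log (1 / δ) := by
    rw [← Real.log_mul hk.ne' (by positivity)]
    congr 1
    field_simp
  rw [div_le_iff₀ hη0] at hlarge
  rw [hlog]
  have : b = a + 2 * η := by rw [hη]; ring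
  rw [this]
  linarith

/-- Bounding `F` through real `s` above `G δ` avoids arithmetic with infinite values of `G`. -/
lemma limsup_div_log_le_limsup_div_log {F G : ℝ → EReal} {k C : ℝ} (hk : 0 < k)
    (h : ∀ η > 0, ∀ᶠ δ in 𝓝[>] (0 : ℝ), ∀ s : ℝ, G δ < s →
      F (k * δ) ≤ ((s + η * Real.log (1 / δ) + C : ℝ) : EReal)) :
    limsup (fun δ : ℝ => F δ / ((Real.log (1 / δ) : ℝ) : EReal)) (𝓝[>] 0) ≤
      limsup (fun δ : ℝ => G δ / ((Real.log (1 / δ) : ℝ) : EReal)) (𝓝[>] 0) := by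
  refine EReal.le_of_forall_lt_iff_le.1 fun a ha => limsup_div_log_le hk (C := C) fun η hη => ?_
  filter_upwards [h η hη, eventually_lt_of_limsup_div_log_lt ha] with δ hδ hG
  exact hδ _ hG

/-! ### Bowen metrics and Birkhoff sums -/

lemma abs_birkhoffSum_le {X : Type*} {T : X → X} {f : X → ℝ} {B : ℝ} (hB : ∀ x, |f x| ≤ B)
    (n : ℕ) (x : X) : |birkhoffSum T f n x| ≤ n * B := by
  refine (Finset.abs_sum_le_sum_abs _ _).trans ?_
  simpa using Finset.sum_le_card_nsmul (Finset.range n) (fun j => |f (T^[j] x)|) B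
    fun j _ => hB _

lemma ballWeight_anti {X : Type*} (T : X → X) (f : X → ℝ) (δ : ℝ) (p : ℕ × X) :
    Antitone fun s => ballWeight T f δ s p := by
  intro s t hst
  refine ENNReal.ofReal_le_ofReal (Real.exp_le_exp.2 ?_)
  have := mul_le_mul_of_nonneg_left hst (Nat.cast_nonneg (α := ℝ) p.1)
  linarith

variable {X : Type*} [MetricSpace X]

lemma bowenDist_lt_iff {T : X → X} {n : ℕ} {x y : X} {r : ℝ} (hr : 0 < r) :
    bowenDist T n x y < r ↔ ∀ j < n, dist (T^[j] x) (T^[j] y) < r := by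
  lift r to ℝ≥0 using hr.le
  rw [bowenDist, NNReal.coe_lt_coe, Finset.sup_lt_iff (by exact_mod_cast hr)]
  simp only [Finset.mem_range, ← NNReal.coe_lt_coe, coe_nndist]

lemma bowenDist_le_iff {T : X → X} {n : ℕ} {x y : X} {r : ℝ} (hr : 0 ≤ r) :
    bowenDist T n x y ≤ r ↔ ∀ j < n, dist (T^[j] x) (T^[j] y) ≤ r := by
  lift r to ℝ≥0 using hr
  rw [bowenDist, NNReal.coe_le_coe, Finset.sup_le_iff]
  simp only [Finset.mem_range, ← NNReal.coe_le_coe, coe_nndist]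

lemma isOpen_bowenBall {T : X → X} (hT : Continuous T) (n : ℕ) (x : X) {r : ℝ} (hr : 0 < r) :
    IsOpen (bowenBall T n x r) := by
  have : bowenBall T n x r = ⋂ j ∈ Set.Iio n, {y | dist (T^[j] x) (T^[j] y) < r} := by
    ext y
    simp [bowenBall, bowenDist_lt_iff hr]
  rw [this]
  exact (Set.finite_Iio n).isOpen_biInter fun j _ =>
    isOpen_lt (continuous_const.dist (hT.iterate j)) continuous_const

lemma mem_bowenBall_self (T : X → X) (n : ℕ) (x : X) {r : ℝ} (hr : 0 < r) :
    x ∈ bowenBall T n x r :=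
  (bowenDist_lt_iff hr).2 fun j _ => by simpa using hr

lemma bowenBall_subset_closedBowenBall (T : X → X) (n : ℕ) (x : X) (r : ℝ) :
    bowenBall T n x r ⊆ closedBowenBall T n x r :=
  fun y (hy : bowenDist T n x y < r) => hy.le

/-- Along orbits staying `δ`-close, Birkhoff sums differ by at most `n` times the oscillation. -/
lemma birkhoffSum_le_of_bowenDist_le {T : X → X} {f : X → ℝ} {δ η : ℝ} (hδ : 0 ≤ δ)
    (hη : ∀ x y, dist x y ≤ δ → f y ≤ f x + η) {n : ℕ} {x y : X} (h : bowenDist T n x y ≤ δ) :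
    birkhoffSum T f n y ≤ birkhoffSum T f n x + n * η := by
  have := Finset.sum_le_sum (s := Finset.range n) fun j hj =>
    hη _ _ ((bowenDist_le_iff hδ).1 h j (Finset.mem_range.1 hj))
  simpa [birkhoffSum, Finset.sum_add_distrib] using this

lemma bowenDist_comm (T : X → X) (n : ℕ) (x y : X) : bowenDist T n x y = bowenDist T n y x := by
  simp only [bowenDist, nndist_comm]

lemma eventually_oscillation_le [CompactSpace X] {f : X → ℝ} (hf : Continuous f) {η : ℝ}
    (hη : 0 < η) : ∀ᶠ δ in 𝓝[>] (0 : ℝ), ∀ x y, dist x y ≤ δ → f y ≤ f x + η := by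
  obtain ⟨r, hr, h⟩ := Metric.uniformContinuous_iff.1
    (CompactSpace.uniformContinuous_of_continuous hf) η hη
  filter_upwards [Ioo_mem_nhdsGT hr] with δ hδ x y hxy
  have := h (hxy.trans_lt hδ.2)
  rw [Real.dist_eq] at this
  linarith [neg_abs_le (f x - f y)]

lemma exists_abs_le [CompactSpace X] {f : X → ℝ} (hf : Continuous f) :
    ∃ B, ∀ x, |f x| ≤ B := by
  obtain ⟨B, hB⟩ := isCompact_univ.exists_bound_of_continuousOn hf.continuousOn
  exact ⟨B, fun x => hB x trivial⟩

/-! ### Elementary properties of the outer quantities -/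

lemma ofReal_one_div_rpow {δ : ℝ} (hδ : 0 < δ) (t : ℝ) :
    ENNReal.ofReal ((1 / δ) ^ t) = ENNReal.ofReal (Real.exp (Real.log (1 / δ) * t)) := by
  rw [Real.rpow_def_of_pos (by positivity)]

lemma bowenOuter_anti (T : X → X) (f : X → ℝ) (Z : Set X) (δ : ℝ) :
    Antitone fun s => bowenOuter T f Z δ s := fun _ _ hst =>
  iSup_mono fun _ => iInf₂_mono fun _ _ => ENNReal.tsum_le_tsum fun _ => ballWeight_anti _ _ _ _ hst

lemma bowenOuter_eq_zero_of_bowenCritical_lt {T : X → X} {f : X → ℝ} {Z : Set X} {δ s : ℝ}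
    (h : bowenCritical T f Z δ < s) : bowenOuter T f Z δ s = 0 := by
  simp only [bowenCritical, iInf_lt_iff] at h
  obtain ⟨t, ht, hts⟩ := h
  exact le_antisymm ((bowenOuter_anti T f Z δ (EReal.coe_lt_coe_iff.1 hts).le).trans ht.le)
    zero_le

lemma bowenCritical_le {T : X → X} {f : X → ℝ} {Z : Set X} {δ s : ℝ}
    (h : bowenOuter T f Z δ s = 0) : bowenCritical T f Z δ ≤ s :=
  iInf₂_le s h

lemma bowenPre_le_tsum (T : X → X) (f : X → ℝ) {Z : Set X} {ι : Type*} [Countable ι]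
    {A : ι → Set X} (hZ : Z ⊆ ⋃ i, A i) (δ s : ℝ) (N : ℕ) :
    bowenPre T f Z δ s N ≤ ∑' i, bowenPre T f (A i) δ s N := by
  refine ENNReal.le_of_forall_pos_le_add fun e he hfin => ?_
  obtain ⟨e', he', hsum⟩ := ENNReal.exists_pos_sum_of_countable'
    (ENNReal.coe_ne_zero.2 he.ne') ι
  have hlt : ∀ i, ∃ C, IsBowenCover T (A i) δ N C ∧
      ∑' p : C, ballWeight T f δ s p < bowenPre T f (A i) δ s N + e' i := by
    intro i
    have hi : bowenPre T f (A i) δ s N < bowenPre T f (A i) δ s N + e' i :=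
      ENNReal.lt_add_right (ENNReal.ne_top_of_tsum_ne_top hfin.ne i) (he' i).ne'
    conv_lhs at hi => rw [bowenPre]
    simpa only [iInf_lt_iff, exists_prop] using hi
  choose C hC hCs using hlt
  have hcov : IsBowenCover T Z δ N (⋃ i, C i) := by
    refine ⟨Set.countable_iUnion fun i => (hC i).1, ?_, ?_⟩
    · simp only [Set.mem_iUnion]
      rintro p ⟨i, hi⟩
      exact (hC i).2.1 p hi
    · intro x hx
      obtain ⟨i, hi⟩ := Set.mem_iUnion.1 (hZ hx)
      obtain ⟨p, hp, hxp⟩ := Set.mem_iUnion₂.1 ((hC i).2.2 hi)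
      exact Set.mem_iUnion₂.2 ⟨p, Set.mem_iUnion.2 ⟨i, hp⟩, hxp⟩
  calc bowenPre T f Z δ s N ≤ ∑' p : ⋃ i, C i, ballWeight T f δ s p := iInf₂_le _ hcov
    _ ≤ ∑' i, ∑' p : C i, ballWeight T f δ s p := ENNReal.tsum_iUnion_le_tsum _ _
    _ ≤ ∑' i, (bowenPre T f (A i) δ s N + e' i) := ENNReal.tsum_le_tsum fun i => (hCs i).le
    _ = ∑' i, bowenPre T f (A i) δ s N + ∑' i, e' i := ENNReal.tsum_add
    _ ≤ _ := by gcongr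

lemma bowenOuter_le_tsum (T : X → X) (f : X → ℝ) {Z : Set X} {ι : Type*} [Countable ι]
    {A : ι → Set X} (hZ : Z ⊆ ⋃ i, A i) (δ s : ℝ) :
    bowenOuter T f Z δ s ≤ ∑' i, bowenOuter T f (A i) δ s :=
  iSup_le fun N => (bowenPre_le_tsum T f hZ δ s N).trans <|
    ENNReal.tsum_le_tsum fun i => le_iSup (fun N => bowenPre T f (A i) δ s N) N

/-! ### Packing dimension is at most the spanning dimension -/

lemma spanningSum_lt_of_log_div_lt {T : X → X} {f : X → ℝ} {Z : Set X} {δ t : ℝ} {n : ℕ}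
    (hn : 0 < n) (h : ENNReal.log (spanningSum T f Z δ n) / (n : EReal) < t) :
    spanningSum T f Z δ n < ENNReal.ofReal (Real.exp (n * t)) := by
  have hn' : ((n : ℝ) : EReal) = (n : EReal) := rfl
  rw [← hn', EReal.div_lt_iff (by exact_mod_cast hn) (EReal.coe_ne_top _), ← EReal.coe_mul] at h
  rw [← ENNReal.log_lt_log_iff, ENNReal.log_ofReal_of_pos (Real.exp_pos _), Real.log_exp, mul_comm]
  exact h

/-- A packing maps injectively into spanning sets, by moving every centre to a nearby point. -/
lemma tsum_ballWeight_packing_le {T : X → X} {f : X → ℝ} {Z : Set X} {δ η s t : ℝ} (hδ : 0 < δ)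
    (hδ1 : δ < 1) (hη : ∀ x y, dist x y ≤ δ → f y ≤ f x + η) {N : ℕ}
    (hN : ∀ n, N ≤ n → spanningSum T f Z δ n < ENNReal.ofReal (Real.exp (n * t)))
    {C : Set (ℕ × X)} (hC : IsBowenPacking T Z δ N C) :
    ∑' p : C, ballWeight T f δ (s + η * Real.log (1 / δ)) p ≤
      ∑' k : ℕ, ENNReal.ofReal (Real.exp (-(s - t))) ^ (k + N) := by
  set L := Real.log (1 / δ) with hL
  have hL0 : 0 ≤ L := Real.log_nonneg (by rw [le_div_iff₀ hδ]; linarith)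
  have hE : ∀ k, ∃ E, IsSpanningSet T (k + N) δ Z E ∧
      ∑' x : E, ENNReal.ofReal (Real.exp (L * birkhoffSum T f (k + N) x)) <
        ENNReal.ofReal (Real.exp ((k + N : ℕ) * t)) := by
    intro k
    have := hN (k + N) (Nat.le_add_left _ _)
    simpa only [spanningSum, iInf_lt_iff, exists_prop, ofReal_one_div_rpow hδ] using this
  choose E hE hEs using hE
  have hy : ∀ p : C, ∃ y ∈ E (p.1.1 - N), bowenDist T p.1.1 p.1.2 y < δ := by
    intro p
    obtain ⟨y, hy, hd⟩ := hE (p.1.1 - N) p.1.2 (hC.2.1 p p.2).2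
    rw [Nat.sub_add_cancel (hC.2.1 p p.2).1] at hd
    exact ⟨y, hy, hd⟩
  choose y hyE hyd using hy
  -- The indicator extends the sums over the `E k` to all of `ℕ × X`, where injectivity can be used;
  -- the first coordinate is the length minus `N`.
  set h : ℕ × X → ℝ≥0∞ := fun q => ENNReal.ofReal (Real.exp (-((q.1 + N : ℕ) * s))) *
    (E q.1).indicator (fun z => ENNReal.ofReal (Real.exp (L * birkhoffSum T f (q.1 + N) z))) q.2
    with hh
  have hinj : Function.Injective fun p : C => (p.1.1 - N, y p) := by
    intro p q hpq
    simp only [Prod.mk.injEq] at hpq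
    by_contra hne
    have hdis := hC.2.2 p.2 q.2 (fun h => hne (Subtype.ext h))
    have hp : y p ∈ closedBowenBall T p.1.1 p.1.2 δ := (hyd p).le
    have hq : y p ∈ closedBowenBall T q.1.1 q.1.2 δ := hpq.2 ▸ (hyd q).le
    exact Set.disjoint_left.1 hdis hp hq
  calc ∑' p : C, ballWeight T f δ (s + η * L) p
      ≤ ∑' p : C, h (p.1.1 - N, y p) := by
        refine ENNReal.tsum_le_tsum fun p => ?_
        simp only [hh, Set.indicator_of_mem (hyE p), Nat.sub_add_cancel (hC.2.1 p p.2).1]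
        rw [ballWeight, ← ENNReal.ofReal_mul (Real.exp_nonneg _), ← Real.exp_add]
        refine ENNReal.ofReal_le_ofReal (Real.exp_le_exp.2 ?_)
        -- The sum at the centre must be bounded by the sum at `y p`; the extra `η * L` in the
        -- exponent pays for this move.
        have hd : bowenDist T p.1.1 (y p) p.1.2 ≤ δ := by
          rw [bowenDist_comm]
          exact (hyd p).le
        have := mul_le_mul_of_nonneg_left (birkhoffSum_le_of_bowenDist_le hδ.le hη hd) hL0
        rw [← hL]
        linarith
    _ ≤ ∑' q, h q := ENNReal.tsum_comp_le_tsum_of_injective hinj h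
    _ = ∑' k, ENNReal.ofReal (Real.exp (-((k + N : ℕ) * s))) *
          ∑' x : E k, ENNReal.ofReal (Real.exp (L * birkhoffSum T f (k + N) x)) := by
        rw [ENNReal.tsum_prod']
        refine tsum_congr fun k => ?_
        simp only [hh]
        rw [ENNReal.tsum_mul_left,
          ← tsum_subtype (E k) fun z => ENNReal.ofReal (Real.exp (L * birkhoffSum T f (k + N) z))]
    _ ≤ ∑' k, ENNReal.ofReal (Real.exp (-((k + N : ℕ) * s))) *
          ENNReal.ofReal (Real.exp ((k + N : ℕ) * t)) :=
        ENNReal.tsum_le_tsum fun k => by gcongr; exact (hEs k).le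
    _ = _ := by
        refine tsum_congr fun k => ?_
        rw [← ENNReal.ofReal_mul (Real.exp_nonneg _), ← Real.exp_add,
          ← ENNReal.ofReal_pow (Real.exp_nonneg _), ← Real.exp_nat_mul]
        congr 2
        ring

/-- For `t` strictly between the pressure and `s`, packings with lengths at least `N` have total
weight at most a tail of a convergent geometric series. Hence the packing limit of `Z` itself
vanishes, and the constant decomposition suffices. -/
lemma packingCritical_le_of_spanningPressure_lt {T : X → X} {f : X → ℝ} {Z : Set X} {δ η s : ℝ}
    (hδ : 0 < δ) (hδ1 : δ < 1) (hη : ∀ x y, dist x y ≤ δ → f y ≤ f x + η)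
    (h : spanningPressure T f Z δ < s) :
    packingCritical T f Z δ ≤ ((s + η * Real.log (1 / δ) : ℝ) : EReal) := by
  obtain ⟨t, ht, hts⟩ := EReal.exists_between_coe_real h
  have hts : t < s := by exact_mod_cast hts
  obtain ⟨N₀, hN₀⟩ := eventually_atTop.1
    -- Division by `n = 0` in `EReal` gives `0`, so that index carries no information.
    ((eventually_lt_of_limsup_lt ht).and (eventually_gt_atTop 0))
  have hsum : ∑' k : ℕ, ENNReal.ofReal (Real.exp (-(s - t))) ^ k ≠ ∞ := by
    rw [ENNReal.tsum_geometric]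
    refine ENNReal.inv_ne_top.2 (tsub_pos_of_lt ?_).ne'
    rw [ENNReal.ofReal_lt_one, Real.exp_lt_one_iff]
    linarith
  have hlim : packingLim T f Z δ (s + η * Real.log (1 / δ)) = 0 := by
    refine le_antisymm (ge_of_tendsto (ENNReal.tendsto_sum_nat_add _ hsum) ?_) zero_le
    filter_upwards [eventually_ge_atTop N₀] with N hN
    exact (iInf_le _ N).trans <| iSup₂_le fun C hC => tsum_ballWeight_packing_le hδ hδ1 hη
      (fun n hn => spanningSum_lt_of_log_div_lt (hN₀ n (hN.trans hn)).2 (hN₀ n (hN.trans hn)).1) hC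
  have hout : packingOuter T f Z δ (s + η * Real.log (1 / δ)) = 0 := by
    refine le_antisymm ((iInf₂_le (fun _ => Z) (Set.iUnion_const Z).ge).trans ?_) zero_le
    simp only [hlim, tsum_zero, le_refl]
  exact iInf₂_le (s + η * Real.log (1 / δ)) hout

theorem packingUpperMdim_le_upperMdim [CompactSpace X] {T : X → X} {f : X → ℝ} (hf : Continuous f)
    (Z : Set X) : packingUpperMdim T f Z ≤ upperMdim T f Z := by
  refine limsup_div_log_le_limsup_div_log one_pos (C := 0) fun η hη => ?_
  filter_upwards [eventually_oscillation_le hf hη, Ioo_mem_nhdsGT one_pos] with δ hosc hδ s hs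
  rw [one_mul, add_zero]
  exact packingCritical_le_of_spanningPressure_lt hδ.1 hδ.2 hosc hs

/-! ### Bowen dimension is at most the packing dimension -/

lemma log_one_div_mul_sub {k δ : ℝ} (hk : 0 < k) (hδ : 0 < δ) :
    Real.log (1 / (k * δ)) = Real.log (1 / δ) - Real.log k := by
  rw [one_div, one_div, Real.log_inv, Real.log_inv, Real.log_mul hk.ne' hδ.ne']
  ring

/-- Changing the scale by a factor `k` changes the weighted Birkhoff sums by `O(n)`. -/
lemma log_one_div_mul_birkhoffSum_le {X : Type*} {T : X → X} {f : X → ℝ} {B : ℝ}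
    (hB : ∀ x, |f x| ≤ B) {k δ : ℝ} (hk : 1 ≤ k) (hδ : 0 < δ) (n : ℕ) (x : X) :
    Real.log (1 / (k * δ)) * birkhoffSum T f n x ≤
      Real.log (1 / δ) * birkhoffSum T f n x + n * (B * Real.log k) := by
  rw [log_one_div_mul_sub (by linarith) hδ]
  have h1 := neg_le_of_abs_le (abs_birkhoffSum_le (T := T) hB n x)
  have h2 := mul_le_mul_of_nonneg_left h1 (Real.log_nonneg hk)
  linarith

/-- At a single length, tripling a maximal disjoint family of balls gives a cover. Independence of
`N` and `N'` lets a supremum over `N` be compared with an infimum over `N'`; the shift `B * log 3`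
pays for the change of scale in the weights. -/
lemma bowenPre_le_packingPre [CompactSpace X] {T : X → X} (hT : Continuous T) {f : X → ℝ} {B : ℝ}
    (hB : ∀ x, |f x| ≤ B) (A : Set X) {δ : ℝ} (hδ : 0 < δ) (s : ℝ) (N N' : ℕ) :
    bowenPre T f A (3 * δ) (s + B * Real.log 3) N ≤ packingPre T f A δ s N' := by
  set n := max N N' with hn
  -- With size function `0` the factor `2` plays no role: Vitali only supplies a disjoint subfamily
  -- meeting every ball.
  obtain ⟨u, huA, hdis, hu⟩ := Vitali.exists_disjoint_subfamily_covering_enlargement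
    (fun x => closedBowenBall T n x δ) A (fun _ => 0) 2 one_lt_two (fun _ _ => le_rfl) 0
    (fun _ _ => le_rfl) fun x _ =>
      ⟨x, bowenBall_subset_closedBowenBall _ _ _ _ (mem_bowenBall_self T n x hδ)⟩
  -- The open balls inside the disjoint closed ones are nonempty, open and disjoint in a separable
  -- space.
  have hcount : u.Countable :=
    (hdis.mono fun x => bowenBall_subset_closedBowenBall T n x δ).countable_of_isOpen
      (fun x _ => isOpen_bowenBall hT n x hδ) fun x _ => ⟨x, mem_bowenBall_self T n x hδ⟩
  have hcov : IsBowenCover T A (3 * δ) N (Prod.mk n '' u) := by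
    refine ⟨hcount.image _, ?_, fun x hx => ?_⟩
    · rintro _ ⟨x, _, rfl⟩
      exact le_max_left _ _
    · obtain ⟨y, hy, ⟨z, hzx, hzy⟩, _⟩ := hu x hx
      refine Set.mem_iUnion₂.2 ⟨(n, y), Set.mem_image_of_mem _ hy, ?_⟩
      refine (bowenDist_lt_iff (by positivity)).2 fun j hj => ?_
      have h1 := (bowenDist_le_iff hδ.le).1 hzx j hj
      have h2 := (bowenDist_le_iff hδ.le).1 hzy j hj
      have h3 := dist_triangle_right (T^[j] y) (T^[j] x) (T^[j] z)
      simp only at h3 ⊢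
      linarith
  have hpack : IsBowenPacking T A δ N' (Prod.mk n '' u) := by
    refine ⟨hcount.image _, ?_, ?_⟩
    · rintro _ ⟨x, hx, rfl⟩
      exact ⟨le_max_right _ _, huA hx⟩
    · rintro _ ⟨x, hx, rfl⟩ _ ⟨y, hy, rfl⟩ hxy
      exact hdis hx hy fun h => hxy (by rw [h])
  refine (iInf₂_le _ hcov).trans (le_trans ?_
    (le_iSup₂ (f := fun C (_ : IsBowenPacking T A δ N' C) => ∑' p : C, ballWeight T f δ s p)
      _ hpack))
  refine ENNReal.tsum_le_tsum fun p => ENNReal.ofReal_le_ofReal (Real.exp_le_exp.2 ?_)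
  have := log_one_div_mul_birkhoffSum_le (T := T) hB (k := 3) (by norm_num) hδ p.1.1 p.1.2
  linarith

lemma bowenOuter_le_packingOuter [CompactSpace X] {T : X → X} (hT : Continuous T) {f : X → ℝ}
    {B : ℝ} (hB : ∀ x, |f x| ≤ B) (Z : Set X) {δ : ℝ} (hδ : 0 < δ) (s : ℝ) :
    bowenOuter T f Z (3 * δ) (s + B * Real.log 3) ≤ packingOuter T f Z δ s :=
  le_iInf₂ fun _ hA => (bowenOuter_le_tsum T f hA _ _).trans <|
    ENNReal.tsum_le_tsum fun _ => iSup_le fun _ => le_iInf fun _ =>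
      bowenPre_le_packingPre hT hB _ hδ _ _ _

theorem bowenUpperMdim_le_packingUpperMdim [CompactSpace X] {T : X → X} (hT : Continuous T)
    {f : X → ℝ} (hf : Continuous f) (Z : Set X) :
    bowenUpperMdim T f Z ≤ packingUpperMdim T f Z := by
  obtain ⟨B, hB⟩ := exists_abs_le hf
  refine limsup_div_log_le_limsup_div_log three_pos (C := B * Real.log 3) fun η hη => ?_
  filter_upwards [Ioo_mem_nhdsGT one_pos] with δ hδ s hs
  simp only [packingCritical, iInf_lt_iff] at hs
  obtain ⟨t, ht, hts⟩ := hs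
  have hts : t < s := by exact_mod_cast hts
  have hL : 0 ≤ Real.log (1 / δ) :=
    Real.log_nonneg (by rw [le_div_iff₀ hδ.1]; linarith [hδ.2])
  refine (bowenCritical_le (le_antisymm
    ((bowenOuter_le_packingOuter hT hB Z hδ.1 t).trans ht.le) zero_le)).trans ?_
  have := mul_nonneg hη.le hL
  exact EReal.coe_le_coe_iff.2 (by linarith)

/-! ### Monotonicity of the spanning dimension -/

theorem upperMdim_mono (T : X → X) (f : X → ℝ) {Z Z' : Set X} (h : Z ⊆ Z') :
    upperMdim T f Z ≤ upperMdim T f Z' := by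
  refine limsup_le_limsup ?_
  filter_upwards [tendsto_log_one_div_nhdsGT_zero.eventually_ge_atTop 0] with δ hδ
  refine EReal.div_le_div_right_of_nonneg (by exact_mod_cast hδ) (limsup_le_limsup ?_)
  refine Eventually.of_forall fun n => EReal.div_le_div_right_of_nonneg (by positivity) ?_
  exact ENNReal.log_monotone <| le_iInf₂ fun E hE => iInf₂_le E fun x hx => hE x (h hx)

/-! ### Spanning dimension of the whole space is at most its Bowen dimension -/

/-- `Z` is covered by sets of `d_n`-diameter less than `r`, and the suprema of `exp (L S_n f)` over
these sets sum up to at most `c`. -/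
def HasDiamCover (T : X → X) (f : X → ℝ) (L r : ℝ) (n : ℕ) (Z : Set X) (c : ℝ≥0∞) : Prop :=
  ∃ 𝒱 : Set (Set X), Z ⊆ ⋃₀ 𝒱 ∧ (∀ V ∈ 𝒱, ∀ y ∈ V, ∀ z ∈ V, bowenDist T n y z < r) ∧
    ∑' V : 𝒱, ⨆ y ∈ V.1, ENNReal.ofReal (Real.exp (L * birkhoffSum T f n y)) ≤ c

lemma ennreal_tsum_image_le {α β : Type*} (g : α → β) (S : Set α) (φ : β → ℝ≥0∞) :
    ∑' b : g '' S, φ b ≤ ∑' a : S, φ (g a) := by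
  have h := ENNReal.tsum_iUnion_le_tsum φ fun a : S => {g a}
  have himage : g '' S = ⋃ a : S, {g a} := by
    ext b
    simp [eq_comm]
  rw [← himage] at h
  simpa using h

namespace HasDiamCover

variable {T : X → X} {f : X → ℝ} {L r : ℝ} {n : ℕ} {Z : Set X} {c : ℝ≥0∞}

lemma mono {c' : ℝ≥0∞} (h : HasDiamCover T f L r n Z c) (hc : c ≤ c') :
    HasDiamCover T f L r n Z c' := by
  obtain ⟨𝒱, h1, h2, h3⟩ := h
  exact ⟨𝒱, h1, h2, h3.trans hc⟩

lemma biUnion {ι : Type*} {F : Finset ι} {A : ι → Set X} {b : ι → ℝ≥0∞}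
    (hZ : Z ⊆ ⋃ i ∈ F, A i) (h : ∀ i ∈ F, HasDiamCover T f L r n (A i) (b i)) :
    HasDiamCover T f L r n Z (∑ i ∈ F, b i) := by
  have h' : ∀ i, ∃ 𝒱 : Set (Set X), i ∈ F → A i ⊆ ⋃₀ 𝒱 ∧
      (∀ V ∈ 𝒱, ∀ y ∈ V, ∀ z ∈ V, bowenDist T n y z < r) ∧
      ∑' V : 𝒱, ⨆ y ∈ V.1, ENNReal.ofReal (Real.exp (L * birkhoffSum T f n y)) ≤ b i := by
    intro i
    by_cases hi : i ∈ F
    · obtain ⟨𝒱, h𝒱⟩ := h i hi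
      exact ⟨𝒱, fun _ => h𝒱⟩
    · exact ⟨∅, fun h => absurd h hi⟩
  choose 𝒱 h𝒱 using h'
  refine ⟨⋃ i ∈ F, 𝒱 i, fun x hx => ?_, fun V hV => ?_, ?_⟩
  · obtain ⟨i, hi, hxi⟩ := Set.mem_iUnion₂.1 (hZ hx)
    obtain ⟨V, hV, hxV⟩ := (h𝒱 i hi).1 hxi
    exact ⟨V, Set.mem_iUnion₂.2 ⟨i, hi, hV⟩, hxV⟩
  · obtain ⟨i, hi, hV⟩ := Set.mem_iUnion₂.1 hV
    exact (h𝒱 i hi).2.1 V hV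
  · exact (ENNReal.tsum_biUnion_le
      (fun V : Set X => ⨆ y ∈ V, ENNReal.ofReal (Real.exp (L * birkhoffSum T f n y))) F 𝒱).trans
      (Finset.sum_le_sum fun i hi => (h𝒱 i hi).2.2)

lemma dist_iterate_lt_two_mul {δ : ℝ} (hδ : 0 < δ) {k : ℕ} {x y z : X} (hy : y ∈ bowenBall T k x δ)
    (hz : z ∈ bowenBall T k x δ) {j : ℕ} (hj : j < k) :
    dist (T^[j] y) (T^[j] z) < 2 * δ := by
  have h1 := (bowenDist_lt_iff hδ).1 hy j hj
  have h2 := (bowenDist_lt_iff hδ).1 hz j hj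
  have h3 := dist_triangle_left (T^[j] y) (T^[j] z) (T^[j] x)
  linarith

/-- Base case of the concatenation: a ball at least as long as required is a single piece, with a
crude weight bound. -/
lemma bowenBall_of_le {δ B : ℝ} (hδ : 0 < δ) (hL : 0 ≤ L) (hB : ∀ x, |f x| ≤ B) {k : ℕ}
    (hnk : n ≤ k) (x : X) :
    HasDiamCover T f L (2 * δ) n (bowenBall T k x δ)
      (ENNReal.ofReal (Real.exp (L * (n * B)))) := by
  refine ⟨{bowenBall T k x δ}, by simp, ?_, ?_⟩
  · rintro V rfl y hy z hz
    exact (bowenDist_lt_iff (by positivity)).2 fun j hj =>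
      dist_iterate_lt_two_mul hδ hy hz (hj.trans_le hnk)
  · rw [tsum_singleton (bowenBall T k x δ)
      fun V => ⨆ y ∈ V, ENNReal.ofReal (Real.exp (L * birkhoffSum T f n y))]
    refine iSup₂_le fun y _ => ENNReal.ofReal_le_ofReal (Real.exp_le_exp.2 ?_)
    exact mul_le_mul_of_nonneg_left ((le_abs_self _).trans (abs_birkhoffSum_le hB n y)) hL

/-- A point of `B_k(x, δ)` whose `k`-th iterate lies in `V` follows `x` for time `k` and then `V`
for time `n`. -/
lemma bowenBall_add {δ η : ℝ} (hδ : 0 < δ) (hL : 0 ≤ L)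
    (hη : ∀ x y, dist x y ≤ δ → f y ≤ f x + η)
    (h : HasDiamCover T f L (2 * δ) n Set.univ c) (k : ℕ) (x : X) :
    HasDiamCover T f L (2 * δ) (k + n) (bowenBall T k x δ)
      (ENNReal.ofReal (Real.exp (L * birkhoffSum T f k x + k * (η * L))) * c) := by
  obtain ⟨𝒱, hcov, hdiam, hsum⟩ := h
  refine ⟨(fun V => bowenBall T k x δ ∩ T^[k] ⁻¹' V) '' 𝒱, fun y hy => ?_, ?_, ?_⟩
  · obtain ⟨V, hV, hyV⟩ := hcov (Set.mem_univ (T^[k] y))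
    exact ⟨_, ⟨V, hV, rfl⟩, hy, hyV⟩
  · rintro _ ⟨V, hV, rfl⟩ y ⟨hy, hyV⟩ z ⟨hz, hzV⟩
    refine (bowenDist_lt_iff (by positivity)).2 fun j hj => ?_
    rcases lt_or_ge j k with hjk | hjk
    · exact dist_iterate_lt_two_mul hδ hy hz hjk
    · have := (bowenDist_lt_iff (by positivity)).1 (hdiam V hV _ hyV _ hzV) (j - k) (by omega)
      rwa [← Function.iterate_add_apply, ← Function.iterate_add_apply,
        Nat.sub_add_cancel hjk] at this
  · refine (ennreal_tsum_image_le _ _ fun V =>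
      ⨆ y ∈ V, ENNReal.ofReal (Real.exp (L * birkhoffSum T f (k + n) y))).trans ?_
    refine le_trans (ENNReal.tsum_le_tsum fun V => ?_)
      (ENNReal.tsum_mul_left.le.trans (mul_le_mul_right hsum _))
    refine iSup₂_le fun y hy => ?_
    refine le_trans ?_ (mul_le_mul_right (le_iSup₂ (f := fun z (_ : z ∈ V.1) =>
      ENNReal.ofReal (Real.exp (L * birkhoffSum T f n z))) (T^[k] y) hy.2) _)
    rw [← ENNReal.ofReal_mul (Real.exp_nonneg _), ← Real.exp_add]
    refine ENNReal.ofReal_le_ofReal (Real.exp_le_exp.2 ?_)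
    -- `S_{k+n} f y` splits at time `k`: the first part is compared with the orbit of `x`, the
    -- second is controlled by `V`.
    have hxy : bowenDist T k x y ≤ δ := le_of_lt hy.1
    have := mul_le_mul_of_nonneg_left (birkhoffSum_le_of_bowenDist_le hδ.le hη hxy) hL
    rw [birkhoffSum_add]
    linarith

/-- Any point of a nonempty piece spans that piece, and its weight is below the supremum over the
piece. -/
lemma spanningSum_le {k δ B : ℝ} (hk : 1 ≤ k) (hδ : 0 < δ) (hB : ∀ x, |f x| ≤ B)
    (h : HasDiamCover T f (Real.log (1 / δ)) (k * δ) n Z c) :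
    spanningSum T f Z (k * δ) n ≤ ENNReal.ofReal (Real.exp (n * (B * Real.log k))) * c := by
  obtain ⟨𝒱, hcov, hdiam, hsum⟩ := h
  have hkδ : 0 < k * δ := mul_pos (by linarith) hδ
  set 𝒲 : Set (Set X) := {V ∈ 𝒱 | V.Nonempty}
  choose y hy using fun V : 𝒲 => V.2.2
  have hspan : IsSpanningSet T n (k * δ) Z (y '' Set.univ) := by
    intro x hx
    obtain ⟨V, hV, hxV⟩ := hcov hx
    exact ⟨y ⟨V, hV, ⟨x, hxV⟩⟩, Set.mem_image_of_mem _ trivial,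
      hdiam V hV x hxV _ (hy ⟨V, hV, ⟨x, hxV⟩⟩)⟩
  refine (iInf₂_le _ hspan).trans ((ennreal_tsum_image_le y Set.univ
    fun x => ENNReal.ofReal ((1 / (k * δ)) ^ birkhoffSum T f n x)).trans ?_)
  rw [tsum_univ fun V : 𝒲 => ENNReal.ofReal ((1 / (k * δ)) ^ birkhoffSum T f n (y V))]
  refine le_trans (ENNReal.tsum_le_tsum fun V => ?_) (ENNReal.tsum_mul_left.le.trans
    (mul_le_mul_right ((ENNReal.tsum_mono_subtype (fun V : Set X =>
      ⨆ y ∈ V, ENNReal.ofReal (Real.exp (Real.log (1 / δ) * birkhoffSum T f n y)))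
      (Set.sep_subset 𝒱 Set.Nonempty)).trans hsum) _))
  refine le_trans ?_ (mul_le_mul_right (le_iSup₂ (f := fun z (_ : z ∈ V.1) =>
    ENNReal.ofReal (Real.exp (Real.log (1 / δ) * birkhoffSum T f n z))) (y V) (hy V)) _)
  rw [ofReal_one_div_rpow hkδ, ← ENNReal.ofReal_mul (Real.exp_nonneg _), ← Real.exp_add]
  refine ENNReal.ofReal_le_ofReal (Real.exp_le_exp.2 ?_)
  have := log_one_div_mul_birkhoffSum_le (T := T) hB hk hδ n (y V)
  linarith

/-- Concatenating the balls of a finite cover of total weight at most one yields covers of every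
length. -/
lemma exists_univ {δ η s B : ℝ} (hδ : 0 < δ) (hδ1 : δ < 1) (hB : ∀ x, |f x| ≤ B)
    (hη : ∀ x y, dist x y ≤ δ → f y ≤ f x + η) {F : Finset (ℕ × X)} (hF : ∀ p ∈ F, 1 ≤ p.1)
    (hcov : Set.univ ⊆ ⋃ p ∈ F, bowenBall T p.1 p.2 δ)
    (hsum : ∑ p ∈ F, ballWeight T f δ s p ≤ 1) :
    ∃ d : ℝ, ∀ n : ℕ, HasDiamCover T f (Real.log (1 / δ)) (2 * δ) n Set.univ
      (ENNReal.ofReal (Real.exp (d + n * (s + η * Real.log (1 / δ))))) := by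
  set L := Real.log (1 / δ) with hLdef
  have hL : 0 ≤ L := Real.log_nonneg (by rw [le_div_iff₀ hδ]; linarith)
  -- `g (p, n)` is the least `d` for which the crude bound suffices in the base case `n ≤ p.1`; only
  -- finitely many pairs occur.
  set g : (ℕ × X) × ℕ → ℝ := fun q =>
    L * (q.2 * B) - q.2 * (s + η * L) + q.1.1 * s - L * birkhoffSum T f q.1.1 q.1.2 with hg
  obtain ⟨d, hd⟩ := ((F ×ˢ Finset.range (F.sup Prod.fst + 1)).image g).bddAbove
  refine ⟨d, fun n => ?_⟩
  induction n using Nat.strong_induction_on with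
  | _ n ih =>
  have hball : ∀ p ∈ F, HasDiamCover T f L (2 * δ) n (bowenBall T p.1 p.2 δ)
      (ENNReal.ofReal (Real.exp (d + n * (s + η * L))) * ballWeight T f δ s p) := by
    intro p hp
    rw [ballWeight, ← ENNReal.ofReal_mul (Real.exp_nonneg _), ← Real.exp_add, ← hLdef]
    rcases le_or_gt n p.1 with hnp | hnp
    · refine (bowenBall_of_le hδ hL hB hnp p.2).mono
        (ENNReal.ofReal_le_ofReal (Real.exp_le_exp.2 ?_))
      have hmem : g (p, n) ≤ d := hd <| Finset.mem_coe.2 <| Finset.mem_image_of_mem g <|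
        Finset.mem_product.2 ⟨hp, Finset.mem_range.2 <| Nat.lt_succ_of_le <|
          hnp.trans (Finset.le_sup (f := Prod.fst) hp)⟩
      simp only [hg] at hmem
      linarith
    · obtain ⟨k, rfl⟩ := Nat.exists_eq_add_of_le hnp.le
      -- Positive ball lengths make the remaining time strictly shorter, so the induction applies.
      have hk : k < p.1 + k := by have := hF p hp; omega
      refine (bowenBall_add hδ hL hη (ih k hk) p.1 p.2).mono ?_
      rw [← ENNReal.ofReal_mul (Real.exp_nonneg _), ← Real.exp_add]
      refine ENNReal.ofReal_le_ofReal (Real.exp_le_exp.2 (le_of_eq ?_))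
      push_cast
      ring
  -- Total weight at most 1 reproduces the same constant `d` at every length.
  refine (biUnion hcov hball).mono ?_
  rw [← Finset.mul_sum]
  exact mul_le_of_le_one_right' hsum

end HasDiamCover

lemma spanningPressure_le {T : X → X} {f : X → ℝ} {Z : Set X} {δ a d : ℝ}
    (h : ∀ n : ℕ, spanningSum T f Z δ n ≤ ENNReal.ofReal (Real.exp (d + n * a))) :
    spanningPressure T f Z δ ≤ a := by
  refine EReal.le_of_forall_lt_iff_le.1 fun b hab => ?_
  have hab : 0 < b - a := sub_pos.2 (by exact_mod_cast hab)
  refine limsup_le_of_le (h := ?_)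
  filter_upwards [eventually_gt_atTop 0,
    tendsto_natCast_atTop_atTop.eventually_ge_atTop (d / (b - a))] with n hn hnd
  have hn' : ((n : ℝ) : EReal) = (n : EReal) := rfl
  rw [← hn', EReal.div_le_iff_le_mul (by exact_mod_cast hn) (EReal.coe_ne_top _), ← EReal.coe_mul]
  refine (ENNReal.log_monotone (h n)).trans ?_
  rw [ENNReal.log_ofReal_of_pos (Real.exp_pos _), Real.log_exp]
  rw [div_le_iff₀ hab] at hnd
  exact EReal.coe_le_coe_iff.2 (by linarith)

lemma spanningPressure_univ_le_of_bowenCritical_lt [CompactSpace X] {T : X → X}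
    (hT : Continuous T) {f : X → ℝ} {δ η s B : ℝ} (hδ : 0 < δ) (hδ1 : δ < 1)
    (hB : ∀ x, |f x| ≤ B) (hη : ∀ x y, dist x y ≤ δ → f y ≤ f x + η)
    (h : bowenCritical T f Set.univ δ < s) :
    spanningPressure T f Set.univ (2 * δ) ≤
      ((s + η * Real.log (1 / δ) + B * Real.log 2 : ℝ) : EReal) := by
  -- `N = 1` excludes balls of length `0`, which would stall the concatenation.
  have hpre : bowenPre T f Set.univ δ s 1 < 1 :=
    (le_iSup (fun N => bowenPre T f Set.univ δ s N) 1).trans_lt <| by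
      change bowenOuter T f Set.univ δ s < 1
      rw [bowenOuter_eq_zero_of_bowenCritical_lt h]
      exact one_pos
  simp only [bowenPre, iInf_lt_iff] at hpre
  obtain ⟨C, ⟨-, hC1, hC⟩, hCs⟩ := hpre
  obtain ⟨b, hbC, hbfin, hb⟩ := isCompact_univ.elim_finite_subcover_image
    (fun p _ => isOpen_bowenBall hT p.1 p.2 hδ) hC
  lift b to Finset (ℕ × X) using hbfin
  have hsum : ∑ p ∈ b, ballWeight T f δ s p ≤ 1 := by
    rw [← Finset.tsum_subtype]
    exact (ENNReal.tsum_mono_subtype (fun p => ballWeight T f δ s p) hbC).trans hCs.le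
  obtain ⟨d, hd⟩ := HasDiamCover.exists_univ hδ hδ1 hB hη (fun p hp => hC1 p (hbC hp)) hb hsum
  refine spanningPressure_le (d := d) fun n =>
    ((hd n).spanningSum_le one_le_two hδ hB).trans (le_of_eq ?_)
  rw [← ENNReal.ofReal_mul (Real.exp_nonneg _), ← Real.exp_add]
  congr 2
  ring

theorem upperMdim_univ_le_bowenUpperMdim_univ [CompactSpace X] {T : X → X} (hT : Continuous T)
    {f : X → ℝ} (hf : Continuous f) :
    upperMdim T f Set.univ ≤ bowenUpperMdim T f Set.univ := by
  obtain ⟨B, hB⟩ := exists_abs_le hf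
  refine limsup_div_log_le_limsup_div_log two_pos (C := B * Real.log 2) fun η hη => ?_
  filter_upwards [eventually_oscillation_le hf hη, Ioo_mem_nhdsGT one_pos] with δ hosc hδ s hs
  exact spanningPressure_univ_le_of_bowenCritical_lt hT hδ.1 hδ.2 hB hosc hs

/-! ### Finite stability of the Bowen dimension and stable blocks -/

/-- Take the piece of largest dimension. Above it, finiteness gives one range of small `δ` on which
all the outer quantities vanish, and subadditivity passes this to `Z`. -/
theorem exists_bowenUpperMdim_le {T : X → X} {f : X → ℝ} {Z : Set X} {ι : Type*} {t : Finset ι}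
    (ht : t.Nonempty) {A : ι → Set X} (hZ : Z ⊆ ⋃ i ∈ t, A i) :
    ∃ i ∈ t, bowenUpperMdim T f Z ≤ bowenUpperMdim T f (A i) := by
  obtain ⟨i, hi, hmax⟩ := t.exists_max_image (fun i => bowenUpperMdim T f (A i)) ht
  refine ⟨i, hi, EReal.le_of_forall_lt_iff_le.1 fun a ha => ?_⟩
  refine limsup_div_log_le one_pos (C := 0) fun η hη => ?_
  have hev : ∀ᶠ δ in 𝓝[>] (0 : ℝ), ∀ j ∈ t,
      bowenCritical T f (A j) δ < ((a * Real.log (1 / δ) : ℝ) : EReal) :=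
    (Filter.eventually_all_finset t).2 fun j hj =>
      eventually_lt_of_limsup_div_log_lt ((hmax j hj).trans_lt ha)
  filter_upwards [hev, tendsto_log_one_div_nhdsGT_zero.eventually_ge_atTop 0] with δ hδ hL
  have hZ' : Z ⊆ ⋃ j : t, A j := by rwa [Set.iUnion_subtype]
  have hzero : bowenOuter T f Z δ (a * Real.log (1 / δ)) = 0 := by
    refine le_antisymm ((bowenOuter_le_tsum T f hZ' _ _).trans (le_of_eq ?_)) zero_le
    exact ENNReal.tsum_eq_zero.2 fun j => bowenOuter_eq_zero_of_bowenCritical_lt (hδ j j.2)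
  rw [one_mul]
  refine (bowenCritical_le hzero).trans (EReal.coe_le_coe_iff.2 ?_)
  have := mul_nonneg hη.le hL
  linarith

lemma stableBlock_mem_nhds {T : X → X} (hT : Continuous T) {ε : ℝ} (hε : 0 < ε) (m n : ℕ) (x : X) :
    stableBlock T ε m n x ∈ 𝓝 x := by
  have h : ∀ᶠ y in 𝓝 x, ∀ j ∈ Finset.Icc m n, dist (T^[j] x) (T^[j] y) < ε := by
    refine (Filter.eventually_all_finset _).2 fun j _ => ?_
    have hc : Continuous fun y => dist (T^[j] x) (T^[j] y) :=
      continuous_const.dist (hT.iterate j)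
    exact hc.continuousAt.eventually_lt_const (by simpa using hε)
  filter_upwards [h] with y hy j hj using (hy j hj).le

theorem exists_upperMdim_univ_le_bowenUpperMdim_stableBlock [CompactSpace X] [Nonempty X]
    {T : X → X} (hT : Continuous T) {f : X → ℝ} (hf : Continuous f) {ε : ℝ} (hε : 0 < ε)
    (m n : ℕ) :
    ∃ x, upperMdim T f Set.univ ≤ bowenUpperMdim T f (stableBlock T ε m n x) := by
  obtain ⟨t, -, ht⟩ := isCompact_univ.elim_nhds_subcover (stableBlock T ε m n)
    fun x _ => stableBlock_mem_nhds hT hε m n x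
  have hne : t.Nonempty := by
    obtain ⟨x⟩ := ‹Nonempty X›
    obtain ⟨y, hy, -⟩ := Set.mem_iUnion₂.1 (ht (Set.mem_univ x))
    exact ⟨y, hy⟩
  obtain ⟨x, -, hx⟩ := exists_bowenUpperMdim_le (T := T) (f := f) hne ht
  exact ⟨x, (upperMdim_univ_le_bowenUpperMdim_univ hT hf).trans hx⟩

end MeanDim

end

theorem theorem1p1 {X : Type*} [MetricSpace X] [CompactSpace X] [Nonempty X]
    (T : X → X) (hT : Continuous T) (f : C(X, ℝ)) (ε : ℝ) (hε : 0 < ε) (m n : ℕ) (hmn : m ≤ n) :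
    IsGreatest
      (Set.range fun x : X => MeanDim.bowenUpperMdim T f (MeanDim.stableBlock T ε m n x))
      (MeanDim.upperMdim T f Set.univ) ∧
    IsGreatest
      (Set.range fun x : X => MeanDim.packingUpperMdim T f (MeanDim.stableBlock T ε m n x))
      (MeanDim.upperMdim T f Set.univ) ∧
    IsGreatest
      (Set.range fun x : X => MeanDim.upperMdim T f (MeanDim.stableBlock T ε m n x))
      (MeanDim.upperMdim T f Set.univ) := by
  have hf : Continuous f := f.continuous
  have hBP := fun x => MeanDim.bowenUpperMdim_le_packingUpperMdim hT hf
    (MeanDim.stableBlock T ε m n x)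
  have hPS := fun x => MeanDim.packingUpperMdim_le_upperMdim (T := T) hf
    (MeanDim.stableBlock T ε m n x)
  have hSX := fun x => MeanDim.upperMdim_mono T f (Set.subset_univ (MeanDim.stableBlock T ε m n x))
  obtain ⟨x, hx⟩ := MeanDim.exists_upperMdim_univ_le_bowenUpperMdim_stableBlock hT hf hε m n
  refine ⟨⟨⟨x, le_antisymm ((hBP x).trans ((hPS x).trans (hSX x))) hx⟩, ?_⟩,
    ⟨⟨x, le_antisymm ((hPS x).trans (hSX x)) (hx.trans (hBP x))⟩, ?_⟩,
    ⟨⟨x, le_antisymm (hSX x) (hx.trans ((hBP x).trans (hPS x)))⟩, ?_⟩⟩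
  · rintro _ ⟨z, rfl⟩
    exact (hBP z).trans ((hPS z).trans (hSX z))
  · rintro _ ⟨z, rfl⟩
    exact (hPS z).trans (hSX z)
  · rintro _ ⟨z, rfl⟩
    exact hSX z
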